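/- All rings are commutative with identity. Let $C$ be a nonzero ring. For a $C$-algebra $A$ and $\lambda\in C$, the shuffle Baxter algebra of weight $\lambda$ on $A$ is the $C$-module $Ш_C(A)=\bigoplus_{k\ge 0}A^{\otimes(k+1)}$ (tensor powers over $C$) with the product given, for $x=x_0\otimes\cdots\otimes x_m$ and $y=y_0\otimes\cdots\otimes y_n$, by $$x\,y=\sum_{(\sigma,T)}\lambda^{|T|}\,x_0y_0\otimes\sigma\bigl((x_1\otimes\cdots\otimes x_m)\otimes(y_1\otimes\cdots\otimes y_n);T\bigr),$$ and with the operator $P(x_0\otimes\cdots\otimes x_k)=1\otimes x_0\otimes\cdots\otimes x_k$. Here $\sigma$ runs over the permutations of $\{1,\dots,m+n\}$ such that $\sigma^{-1}$ is increasing on $\{1,\dots,m\}$ and on $\{m+1,\dots,m+n\}$, and $T$ over the sets of pairs $(k,k+1)$ with $\sigma(k)\le m<\sigma(k+1)$; with $u=(x_1,\dots,x_m,y_1,\dots,y_n)$, the element $\sigma(\,\cdot\,;T)$ is obtained from $u_{\sigma(1)}\otimes\cdots\otimes u_{\sigma(m+n)}$ by replacing the tensor sign between positions $k$ and $k+1$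 by the product of $A$ for every $(k,k+1)\in T$. For a set $X$ put $Ш_C(X)=Ш_C(C[X])$. A Baxter ideal is an ideal $I$ with $P(I)\subseteq I$. 1. Let $A$ be a $C$-algebra. If $A$ is not a noetherian $C$-module and there is a surjective $C$-linear map $A\to C$, then $Ш_C(A)$ of weight zero does not satisfy the ascending chain condition for Baxter ideals. 2. If $X$ is not empty, then $Ш_C(X)$ of weight zero does not satisfy the ascending chain condition for Baxter ideals. 3. If $X$ is infinite, then for every $\lambda\in C$ the algebra $Ш_C(X)$ of weight $\lambda$ does not satisfy the ascending chain condition for Baxter ideals. -/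

import Mathlib

open scoped DirectSum TensorProduct

namespace ShuffleBaxter

/-! ### Mixable shuffles

Indices start at `0`: the positions `0, …, m + n - 1` of the code stand for `1, …, m + n`. -/

/-- `σ` is an `(m, n)`-shuffle: `σ⁻¹` is increasing on the first `m` indices and on the last `n`
indices. -/
def IsShuffle (m n : ℕ) (σ : Equiv.Perm (Fin (m + n))) : Prop :=
  (∀ i j : Fin m, i < j → σ.symm (Fin.castAdd n i) < σ.symm (Fin.castAdd n j)) ∧
  (∀ i j : Fin n, i < j → σ.symm (Fin.natAdd m i) < σ.symm (Fin.natAdd m j))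

/-- The pair of neighbouring positions `(k, k + 1)` is admissible for `σ`: the entry of `σ` at `k`
is one of the first `m` indices, and the entry at `k + 1` is one of the last `n`. The pair is
recorded by its left member `k`. -/
def IsAdmissible (m n : ℕ) (σ : Equiv.Perm (Fin (m + n))) (k : Fin (m + n)) : Prop :=
  ∃ h : (k : ℕ) + 1 < m + n, (σ k : ℕ) < m ∧ m ≤ (σ ⟨(k : ℕ) + 1, h⟩ : ℕ)

instance (m n : ℕ) (σ : Equiv.Perm (Fin (m + n))) : Decidable (IsShuffle m n σ) := by
  unfold IsShuffle; infer_instance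

instance (m n : ℕ) (σ : Equiv.Perm (Fin (m + n))) (k : Fin (m + n)) :
    Decidable (IsAdmissible m n σ k) := by
  unfold IsAdmissible; infer_instance

/-- The `(m, n)`-mixable shuffles `(σ, T)`: an `(m, n)`-shuffle `σ` with a set `T` of admissible
pairs for `σ`. -/
abbrev MixableShuffle (m n : ℕ) : Type :=
  {s : Equiv.Perm (Fin (m + n)) × Finset (Fin (m + n)) //
    IsShuffle m n s.1 ∧ ∀ k ∈ s.2, IsAdmissible m n s.1 k}

namespace MixableShuffle

variable {m n : ℕ}

/-- The shuffle `σ` of a mixable shuffle `(σ, T)`. -/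
def perm (s : MixableShuffle m n) : Equiv.Perm (Fin (m + n)) := s.1.1

/-- The set `T` of a mixable shuffle `(σ, T)`. -/
def pairs (s : MixableShuffle m n) : Finset (Fin (m + n)) := s.1.2

theorem block_lt (s : MixableShuffle m n) (k : Fin (m + n)) :
    (Finset.univ.filter fun i : Fin (m + n) => i < k ∧ i ∉ s.pairs).card
      < m + n - s.pairs.card := by
  have hpos : 0 < m + n := lt_of_le_of_lt (Nat.zero_le _) k.isLt
  have hlast : (⟨m + n - 1, by omega⟩ : Fin (m + n)) ∉ s.pairs := by
    intro h
    obtain ⟨h', -⟩ := s.2.2 _ h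
    simp only at h'
    omega
  have hc : (s.pairsᶜ).card = m + n - s.pairs.card := by
    rw [Finset.card_compl, Fintype.card_fin]
  rw [← hc]
  apply Finset.card_lt_card
  rw [Finset.ssubset_iff]
  refine ⟨⟨m + n - 1, by omega⟩, ?_, ?_⟩
  · simp only [Finset.mem_filter, Finset.mem_univ, true_and, not_and, Fin.lt_def]
    intro h
    have := k.isLt
    omega
  · intro i hi
    simp only [Finset.mem_insert, Finset.mem_filter, Finset.mem_univ, true_and] at hi
    rw [Finset.mem_compl]
    rcases hi with rfl | hi
    · exact hlast
    · exact hi.2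

/-- The word `u_{σ(1)} … u_{σ(m+n)}` has a tensor sign between positions `k` and `k + 1` unless
`(k, k + 1) ∈ T`, in which case the two letters are multiplied. So the letter at position `k` goes
into the tensor factor whose number is the number of tensor signs to its left. -/
def block (s : MixableShuffle m n) (k : Fin (m + n)) : Fin (m + n - s.pairs.card) :=
  ⟨(Finset.univ.filter fun i : Fin (m + n) => i < k ∧ i ∉ s.pairs).card, s.block_lt k⟩

/-- The tensor factors of the mixable shuffle `σ(u; T)` of the letters `u`. -/
def word {A : Type*} [CommRing A] (s : MixableShuffle m n) (u : Fin (m + n) → A) :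
    Fin (m + n - s.pairs.card) → A :=
  fun j => ∏ k with s.block k = j, u (s.perm k)

end MixableShuffle

/-! ### The shuffle Baxter algebra -/

/-- `Sha C A lam` is the underlying module `A ⊕ A^{⊗2} ⊕ A^{⊗3} ⊕ ⋯` of the shuffle Baxter
`C`-algebra on `A` of weight `lam`; the weight enters through the multiplication. -/
def Sha (C A : Type*) [CommRing C] [CommRing A] [Algebra C A] (_lam : C) : Type _ :=
  ⨁ k : ℕ, ⨂[C]^(k + 1) A

section

variable (C A : Type*) [CommRing C] [CommRing A] [Algebra C A] (lam : C)

noncomputable instance : AddCommGroup (Sha C A lam) :=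
  inferInstanceAs (AddCommGroup (⨁ k : ℕ, ⨂[C]^(k + 1) A))

noncomputable instance : Module C (Sha C A lam) :=
  inferInstanceAs (Module C (⨁ k : ℕ, ⨂[C]^(k + 1) A))

variable {C A}

/-- The inclusion of the summand `A^{⊗(k+1)}`. -/
noncomputable def incl (k : ℕ) : (⨂[C]^(k + 1) A) →ₗ[C] Sha C A lam :=
  DirectSum.lof C ℕ (fun k : ℕ => ⨂[C]^(k + 1) A) k

/-- The pure tensor `x_0 ⊗ ⋯ ⊗ x_k` in `Sha C A lam`. -/
noncomputable def pure {k : ℕ} (x : Fin (k + 1) → A) : Sha C A lam :=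
  incl lam k (PiTensorProduct.tprod C x)

variable (C) in
/-- The family `x_0 y_0, w_1, …, w_r`, where `w_1 ⊗ ⋯ ⊗ w_r = σ(x⁺ ⊗ y⁺; T)` is the mixable
shuffle of `x⁺ = x_1 ⊗ ⋯ ⊗ x_m` and `y⁺ = y_1 ⊗ ⋯ ⊗ y_n`. -/
def mixFactors {m n : ℕ} (s : MixableShuffle m n) (x : Fin (m + 1) → A) (y : Fin (n + 1) → A) :
    Fin (m + n - s.pairs.card + 1) → A :=
  Fin.cons (x 0 * y 0) (s.word (Fin.append (Fin.tail x) (Fin.tail y)))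

/-- The number of the tensor factor into which a letter of `x` or `y` goes. -/
def slot {m n : ℕ} (s : MixableShuffle m n) :
    Fin (m + 1) ⊕ Fin (n + 1) → Fin (m + n - s.pairs.card + 1) :=
  Sum.elim (Fin.cons 0 fun i => (s.block (s.perm.symm (Fin.castAdd n i))).succ)
    (Fin.cons 0 fun j => (s.block (s.perm.symm (Fin.natAdd m j))).succ)

theorem mixFactors_eq {m n : ℕ} (s : MixableShuffle m n) (v : Fin (m + 1) ⊕ Fin (n + 1) → A) :
    mixFactors s (fun i => v (Sum.inl i)) (fun j => v (Sum.inr j))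
      = fun t => ∏ i with slot s i = t, v i := by
  funext t
  rw [Finset.prod_filter, Fintype.prod_sum_type, Fin.prod_univ_succ, Fin.prod_univ_succ]
  refine Fin.cases ?_ (fun t => ?_) t
  · simp [mixFactors, slot, Fin.succ_ne_zero]
  · simp only [mixFactors, Fin.cons_succ, MixableShuffle.word, Finset.prod_filter]
    rw [← Equiv.prod_comp s.perm.symm, Fin.prod_univ_add]
    simp [slot, Fin.tail, (Fin.succ_ne_zero t).symm]

theorem fiberProd_update {ι κ : Type*} [Fintype ι] [DecidableEq ι] [DecidableEq κ] (θ : ι → κ)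
    (v : ι → A) (i : ι) (a : A) :
    (fun t => ∏ l with θ l = t, Function.update v i a l)
      = Function.update (fun t => ∏ l with θ l = t, v l) (θ i)
          ((∏ l ∈ (Finset.univ.filter fun l => θ l = θ i).erase i, v l) * a) := by
  funext t
  by_cases h : t = θ i
  · subst h
    rw [Function.update_self, ← Finset.prod_erase_mul _ _ (a := i) (by simp),
      Function.update_self]
    congr 1
    refine Finset.prod_congr rfl fun l hl => ?_
    rw [Function.update_of_ne (Finset.ne_of_mem_erase hl)]
  · rw [Function.update_of_ne h]
    refine Finset.prod_congr rfl fun l hl => ?_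
    rw [Function.update_of_ne]
    rintro rfl
    exact h (Finset.mem_filter.1 hl).2.symm

/-- The term `λ^|T| x_0 y_0 ⊗ σ(x⁺ ⊗ y⁺; T)` of the product, as a multilinear map in the letters
`x = (v (inl 0), …, v (inl m))` and `y = (v (inr 0), …, v (inr n))`. -/
noncomputable def mixTerm {m n : ℕ} (s : MixableShuffle m n) :
    MultilinearMap C (fun _ : Fin (m + 1) ⊕ Fin (n + 1) => A) (Sha C A lam) where
  toFun v := lam ^ s.pairs.card •
    pure lam (mixFactors s (fun i => v (Sum.inl i)) (fun j => v (Sum.inr j)))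
  map_update_add' v i a b := by
    simp only [mixFactors_eq, fiberProd_update, mul_add, pure, MultilinearMap.map_update_add,
      map_add, smul_add]
  map_update_smul' v i c a := by
    simp only [mixFactors_eq, fiberProd_update, Algebra.mul_smul_comm, pure,
      MultilinearMap.map_update_smul, map_smul]
    rw [smul_comm]

/-- The product of `A^{⊗(m+1)}` and `A^{⊗(n+1)}`. -/
noncomputable def mulGraded (m n : ℕ) :
    (⨂[C]^(m + 1) A) →ₗ[C] (⨂[C]^(n + 1) A) →ₗ[C] Sha C A lam :=
  PiTensorProduct.lift
    ((PiTensorProduct.lift :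
        MultilinearMap C (fun _ : Fin (n + 1) => A) (Sha C A lam) ≃ₗ[C] _).toLinearMap.compMultilinearMap
      (∑ s : MixableShuffle m n, mixTerm lam s).currySum)

/-- The mixed shuffle product as a bilinear map. -/
noncomputable def mulHom : Sha C A lam →ₗ[C] Sha C A lam →ₗ[C] Sha C A lam :=
  DirectSum.toModule C ℕ (Sha C A lam →ₗ[C] Sha C A lam) fun m =>
    LinearMap.flip (DirectSum.toModule C ℕ ((⨂[C]^(m + 1) A) →ₗ[C] Sha C A lam) fun n =>
      (mulGraded lam m n).flip)

noncomputable instance : Mul (Sha C A lam) := ⟨fun x y => mulHom lam x y⟩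

/-- The addition and the mixed shuffle product. -/
noncomputable instance : NonUnitalNonAssocRing (Sha C A lam) :=
  { (inferInstance : AddCommGroup (Sha C A lam)), (inferInstance : Mul (Sha C A lam)) with
    left_distrib := fun x y z => map_add (mulHom lam x) y z
    right_distrib := fun x y z => by
      change mulHom lam (x + y) z = mulHom lam x z + mulHom lam y z
      rw [map_add, LinearMap.add_apply]
    zero_mul := fun x => by
      change mulHom lam 0 x = 0
      rw [map_zero, LinearMap.zero_apply]
    mul_zero := fun x => map_zero (mulHom lam x) }

/-- The mixed shuffle product on pure tensors:
`x y = ∑_{(σ, T)} λ^|T| x_0 y_0 ⊗ σ(x⁺ ⊗ y⁺; T)`. -/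
theorem pure_mul_pure {m n : ℕ} (x : Fin (m + 1) → A) (y : Fin (n + 1) → A) :
    (pure lam x * pure lam y : Sha C A lam)
      = ∑ s : MixableShuffle m n, lam ^ s.pairs.card • pure lam (mixFactors s x y) := by
  change mulHom lam (pure lam x) (pure lam y) = _
  simp only [mulHom, pure, incl]
  erw [DirectSum.toModule_lof, LinearMap.flip_apply, DirectSum.toModule_lof]
  rw [LinearMap.flip_apply, mulGraded, PiTensorProduct.lift.tprod]
  simp only [LinearMap.compMultilinearMap_apply, LinearEquiv.coe_coe]
  rw [PiTensorProduct.lift.tprod, MultilinearMap.currySum_apply, sum_apply]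
  rfl

/-- The Baxter operator `P(x_0 ⊗ ⋯ ⊗ x_k) = 1 ⊗ x_0 ⊗ ⋯ ⊗ x_k`. -/
noncomputable def baxterOp : Sha C A lam →ₗ[C] Sha C A lam :=
  DirectSum.toModule C ℕ (Sha C A lam) fun k =>
    incl lam (k + 1) ∘ₗ
      PiTensorProduct.lift
        ((PiTensorProduct.tprod C (s := fun _ : Fin (k + 1 + 1) => A)).curryLeft (1 : A))

theorem baxterOp_pure {k : ℕ} (x : Fin (k + 1) → A) :
    baxterOp lam (pure lam x : Sha C A lam) = pure lam (Fin.cons 1 x : Fin (k + 1 + 1) → A) := by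
  simp only [baxterOp, pure]
  erw [DirectSum.toModule_lof]
  rw [LinearMap.comp_apply, PiTensorProduct.lift.tprod]
  rfl

end

/-- A Baxter ideal: an ideal `I` with `P(I) ⊆ I`. -/
def BaxterIdeal (C A : Type*) [CommRing C] [CommRing A] [Algebra C A] (lam : C) : Type _ :=
  {I : TwoSidedIdeal (Sha C A lam) // ∀ x ∈ I, baxterOp lam x ∈ I}

/-- Baxter ideals are ordered by inclusion. -/
instance (C A : Type*) [CommRing C] [CommRing A] [Algebra C A] (lam : C) :
    PartialOrder (BaxterIdeal C A lam) :=
  inferInstanceAs (PartialOrder {I : TwoSidedIdeal (Sha C A lam) // ∀ x ∈ I, baxterOp lam x ∈ I})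

/-- The ascending chain condition for Baxter ideals: every ascending sequence of Baxter ideals is
eventually constant. -/
def BaxterACC (C A : Type*) [CommRing C] [CommRing A] [Algebra C A] (lam : C) : Prop :=
  ∀ I : ℕ →o BaxterIdeal C A lam, ∃ N : ℕ, ∀ n, N ≤ n → I N = I n

end ShuffleBaxter

namespace ShuffleBaxter

namespace MixableShuffle

variable {m n : ℕ}

/-! To a submodule `M` of `A` attach the span `tailSpan lam M` of the pure tensors having a factor
in `M` beyond the first one. In weight zero only shuffles without merged letters survive, so such a
factor reappears intact in every term of a product. In any weight, merging is harmless if `M` is an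
ideal of `A`. As `P` only shifts factors to the right, this span is a Baxter ideal (`tailIdeal`).
The first factor is excluded because `x_0 y_0` is a product in every weight.

If `f : A → C` is linear and onto, `M` can be recovered: `x_0 ⊗ x_1 ↦ f(x_0) x_1 mod M` kills the
span, and sends `e ⊗ a` with `f e = 1` to the class of `a` (`le_of_tailSpan_le`). So the chain
condition on Baxter ideals passes to `C`-submodules of `A` in weight zero and to ideals of `A` in
any weight. Polynomial rings violate these conditions, with the constant coefficient as `f`. -/

theorem block_injective_of_pairs_eq_empty (s : MixableShuffle m n) (hs : s.pairs = ∅) :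
    Function.Injective s.block := by
  intro k l h
  -- No tensor sign has been removed, so exactly `k` of them precede position `k`.
  have hcard : ∀ k : Fin (m + n), (s.block k : ℕ) = k := fun k => by
    simp [block, hs, Finset.filter_gt_eq_Iio]
  exact Fin.ext (by rw [← hcard k, ← hcard l, h])

variable {C A : Type*} [CommRing C] [CommRing A] [Algebra C A]

/-- If a letter lies in `M`, then so does the tensor factor it goes into, provided that no letters
are multiplied or that `M` absorbs multiplication. -/
theorem word_block_mem (s : MixableShuffle m n) (u : Fin (m + n) → A) (M : Submodule C A)
    (h : s.pairs = ∅ ∨ ∀ a, ∀ x ∈ M, a * x ∈ M) (k : Fin (m + n)) (hk : u (s.perm k) ∈ M) :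
    s.word u (s.block k) ∈ M := by
  rcases h with h | h
  · have hf : (Finset.univ.filter fun l => s.block l = s.block k) = {k} := by
      ext l
      simpa using (s.block_injective_of_pairs_eq_empty h).eq_iff
    rw [word, hf, Finset.prod_singleton]
    exact hk
  · rw [word, ← Finset.prod_erase_mul _ _ (a := k) (by simp)]
    exact h _ _ hk

end MixableShuffle

/-! ### Baxter ideals attached to submodules -/

section

variable {C A : Type*} [CommRing C] [CommRing A] [Algebra C A] (lam : C)

theorem span_range_pure :
    Submodule.span C {z : Sha C A lam | ∃ (k : ℕ) (x : Fin (k + 1) → A), pure lam x = z} = ⊤ := by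
  rw [eq_top_iff]
  rintro z -
  induction z using DirectSum.induction_on with
  | zero => exact Submodule.zero_mem _
  | add x y hx hy => exact Submodule.add_mem _ hx hy
  | of k t =>
    change incl lam k t ∈ _
    induction t using PiTensorProduct.induction_on with
    | smul_tprod c x =>
      rw [map_smul]
      exact Submodule.smul_mem _ _ (Submodule.subset_span ⟨k, x, rfl⟩)
    | add x y hx hy =>
      rw [map_add]
      exact Submodule.add_mem _ hx hy

/-- The span of the pure tensors `x_0 ⊗ ⋯ ⊗ x_k` with `x_i ∈ M` for some `i ≥ 1`. -/
noncomputable def tailSpan (M : Submodule C A) : Submodule C (Sha C A lam) :=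
  Submodule.span C
    {z | ∃ (k : ℕ) (x : Fin (k + 1) → A) (i : Fin k), x i.succ ∈ M ∧ pure lam x = z}

variable {lam} {M : Submodule C A}

theorem pure_mem_tailSpan {k : ℕ} {x : Fin (k + 1) → A} (i : Fin k) (hi : x i.succ ∈ M) :
    pure lam x ∈ tailSpan lam M :=
  Submodule.subset_span ⟨k, x, i, hi, rfl⟩

/-- In weight zero the coefficient `0 ^ |T|` kills every term with `T` nonempty; in the remaining
terms no letters are merged. -/
theorem smul_pure_mixFactors_mem (hM : lam = 0 ∨ ∀ a, ∀ x ∈ M, a * x ∈ M) {m n : ℕ}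
    (s : MixableShuffle m n) (x : Fin (m + 1) → A) (y : Fin (n + 1) → A) (k : Fin (m + n))
    (hk : Fin.append (Fin.tail x) (Fin.tail y) k ∈ M) :
    lam ^ s.pairs.card • pure lam (mixFactors s x y) ∈ tailSpan lam M := by
  have key : (s.pairs = ∅ ∨ ∀ a, ∀ x ∈ M, a * x ∈ M) →
      pure lam (mixFactors s x y) ∈ tailSpan lam M := fun h => by
    -- Letter `k` stands at position `s.perm.symm k` of the shuffled word.
    refine pure_mem_tailSpan (s.block (s.perm.symm k)) ?_
    rw [mixFactors, Fin.cons_succ]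
    exact s.word_block_mem _ M h _ (by rwa [Equiv.apply_symm_apply])
  rcases hM with hlam | hM
  · by_cases hs : s.pairs = ∅
    · exact Submodule.smul_mem _ _ (key (Or.inl hs))
    · rw [hlam, zero_pow (by simpa using hs), zero_smul]
      exact Submodule.zero_mem _
  · exact Submodule.smul_mem _ _ (key (Or.inr hM))

theorem mul_mem_tailSpan_left (hM : lam = 0 ∨ ∀ a, ∀ x ∈ M, a * x ∈ M) (z : Sha C A lam)
    {w : Sha C A lam} (hw : w ∈ tailSpan lam M) : z * w ∈ tailSpan lam M := by
  have hz : z ∈ Submodule.span C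
      {z : Sha C A lam | ∃ (k : ℕ) (x : Fin (k + 1) → A), pure lam x = z} := by
    rw [span_range_pure]
    trivial
  refine (Submodule.map₂_le (f := mulHom lam)).1 ?_ z hz w hw
  rw [tailSpan, Submodule.map₂_span_span, Submodule.span_le]
  rintro _ ⟨_, ⟨m, x, rfl⟩, _, ⟨n, y, i, hi, rfl⟩, rfl⟩
  change pure lam x * pure lam y ∈ tailSpan lam M
  rw [pure_mul_pure]
  refine Submodule.sum_mem _ fun s _ => smul_pure_mixFactors_mem hM s x y (Fin.natAdd m i) ?_
  rwa [Fin.append_right]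

theorem mul_mem_tailSpan_right (hM : lam = 0 ∨ ∀ a, ∀ x ∈ M, a * x ∈ M) (z : Sha C A lam)
    {w : Sha C A lam} (hw : w ∈ tailSpan lam M) : w * z ∈ tailSpan lam M := by
  have hz : z ∈ Submodule.span C
      {z : Sha C A lam | ∃ (k : ℕ) (x : Fin (k + 1) → A), pure lam x = z} := by
    rw [span_range_pure]
    trivial
  refine (Submodule.map₂_le (f := mulHom lam)).1 ?_ w hw z hz
  rw [tailSpan, Submodule.map₂_span_span, Submodule.span_le]
  rintro _ ⟨_, ⟨m, x, i, hi, rfl⟩, _, ⟨n, y, rfl⟩, rfl⟩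
  change pure lam x * pure lam y ∈ tailSpan lam M
  rw [pure_mul_pure]
  refine Submodule.sum_mem _ fun s _ => smul_pure_mixFactors_mem hM s x y (Fin.castAdd n i) ?_
  rwa [Fin.append_left]

theorem baxterOp_mem_tailSpan {w : Sha C A lam} (hw : w ∈ tailSpan lam M) :
    baxterOp lam w ∈ tailSpan lam M := by
  refine (Submodule.span_le (p := (tailSpan lam M).comap (baxterOp lam))).2 ?_ hw
  rintro _ ⟨k, x, i, hi, rfl⟩
  change baxterOp lam (pure lam x) ∈ tailSpan lam M
  rw [baxterOp_pure]
  exact pure_mem_tailSpan i.succ (by rwa [Fin.cons_succ])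

variable (lam M) in
/-- The Baxter ideal of the tensors that have a factor in `M` other than the first factor. -/
noncomputable def tailIdeal (hM : lam = 0 ∨ ∀ a, ∀ x ∈ M, a * x ∈ M) : BaxterIdeal C A lam :=
  ⟨TwoSidedIdeal.mk' (tailSpan lam M) (Submodule.zero_mem _) (Submodule.add_mem _)
      (Submodule.neg_mem _) (mul_mem_tailSpan_left hM _) (mul_mem_tailSpan_right hM _),
    fun x hx => by
      rw [TwoSidedIdeal.mem_mk'] at hx ⊢
      exact baxterOp_mem_tailSpan hx⟩

theorem mem_tailIdeal {hM : lam = 0 ∨ ∀ a, ∀ x ∈ M, a * x ∈ M} {z : Sha C A lam} :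
    z ∈ (tailIdeal lam M hM).1 ↔ z ∈ tailSpan lam M :=
  TwoSidedIdeal.mem_mk' (tailSpan lam M : Set (Sha C A lam)) (Submodule.zero_mem _)
    (Submodule.add_mem _) (Submodule.neg_mem _) (mul_mem_tailSpan_left hM _)
    (mul_mem_tailSpan_right hM _) z

theorem tailSpan_mono : Monotone (tailSpan lam : Submodule C A → Submodule C (Sha C A lam)) :=
  fun _ _ h => Submodule.span_mono fun _ ⟨k, x, i, hi, hz⟩ => ⟨k, x, i, h hi, hz⟩

/-! ### Recovering the submodule from its ideal -/

/-- The multilinear map `(x_0, x_1) ↦ f(x_0) x_1 mod M`. -/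
noncomputable def evalMkQ (f : A →ₗ[C] C) (M : Submodule C A) :
    MultilinearMap C (fun _ : Fin 2 => A) (A ⧸ M) :=
  MultilinearMap.mk' (fun x => f (x 0) • M.mkQ (x 1))
    (fun x i a b => by fin_cases i <;> simp [add_smul])
    (fun x i c a => by
      fin_cases i
      · simp [mul_smul]
      · simpa using smul_comm _ _ _)

/-- The linear map `x_0 ⊗ x_1 ↦ f(x_0) x_1 mod M`, which vanishes on the other summands. -/
noncomputable def detect (lam : C) (f : A →ₗ[C] C) (M : Submodule C A) :
    Sha C A lam →ₗ[C] A ⧸ M :=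
  PiTensorProduct.lift (evalMkQ f M) ∘ₗ DirectSum.component C ℕ (fun k : ℕ => ⨂[C]^(k + 1) A) 1

theorem detect_pure (f : A →ₗ[C] C) (x : Fin 2 → A) :
    detect lam f M (pure lam (k := 1) x) = f (x 0) • M.mkQ (x 1) := by
  have h : DirectSum.component C ℕ (fun k : ℕ => ⨂[C]^(k + 1) A) 1 (pure lam (k := 1) x) =
      PiTensorProduct.tprod C x :=
    DirectSum.component.lof_self C (M := fun k : ℕ => ⨂[C]^(k + 1) A) 1
      (PiTensorProduct.tprod C x)
  calc detect lam f M (pure lam (k := 1) x)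
      = PiTensorProduct.lift (evalMkQ f M) (PiTensorProduct.tprod C x) :=
        congrArg (PiTensorProduct.lift (evalMkQ f M)) h
    _ = evalMkQ f M x := PiTensorProduct.lift.tprod x
    _ = f (x 0) • M.mkQ (x 1) := rfl

theorem detect_pure_of_ne (f : A →ₗ[C] C) {k : ℕ} (hk : k ≠ 1) (x : Fin (k + 1) → A) :
    detect lam f M (pure lam x) = 0 := by
  refine (congrArg (PiTensorProduct.lift (evalMkQ f M)) ?_).trans (map_zero _)
  exact (DirectSum.component.of C (M := fun k : ℕ => ⨂[C]^(k + 1) A) 1 k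
    (PiTensorProduct.tprod C x)).trans (dif_neg hk)

/-- In `A ⊗ A` the only factor beyond the first is `x_1`, so a generator there has `x_1` in `M`. -/
theorem tailSpan_le_ker_detect (f : A →ₗ[C] C) :
    tailSpan lam M ≤ LinearMap.ker (detect lam f M) := by
  rw [tailSpan, Submodule.span_le]
  rintro _ ⟨k, x, i, hi, rfl⟩
  rw [SetLike.mem_coe, LinearMap.mem_ker]
  by_cases hk : k = 1
  · subst hk
    obtain rfl := Subsingleton.elim i 0
    have h0 : M.mkQ (x 1) = 0 := by simpa using hi
    rw [detect_pure, h0, smul_zero]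
  · exact detect_pure_of_ne f hk x

theorem le_of_tailSpan_le {f : A →ₗ[C] C} (hf : Function.Surjective f) {N : Submodule C A}
    (h : tailSpan lam N ≤ tailSpan lam M) : N ≤ M := by
  intro a ha
  obtain ⟨e, he⟩ := hf 1
  have hmem : pure lam (k := 1) ![e, a] ∈ tailSpan lam N := pure_mem_tailSpan 0 ha
  have hker := LinearMap.mem_ker.1 (tailSpan_le_ker_detect f (h hmem))
  rw [detect_pure] at hker
  simpa [he] using hker

/-- Under the ascending chain condition for Baxter ideals, the ascending chains of submodules of `A`
stabilize, if the weight is zero or the submodules are ideals. -/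
theorem BaxterACC.stabilizes (hacc : BaxterACC C A lam) {f : A →ₗ[C] C}
    (hf : Function.Surjective f) (M : ℕ →o Submodule C A)
    (hM : ∀ n, lam = 0 ∨ ∀ a, ∀ x ∈ M n, a * x ∈ M n) : ∃ N, ∀ n, N ≤ n → M N = M n := by
  obtain ⟨N, hN⟩ := hacc
    ⟨fun n => tailIdeal lam (M n) (hM n), fun i j hij => by
      change (tailIdeal lam (M i) (hM i)).1 ≤ (tailIdeal lam (M j) (hM j)).1
      rw [TwoSidedIdeal.le_iff]
      intro z hz
      exact mem_tailIdeal.2 (tailSpan_mono (M.monotone hij) (mem_tailIdeal.1 hz))⟩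
  refine ⟨N, fun n hn => le_antisymm (M.monotone hn) (le_of_tailSpan_le (lam := lam) hf ?_)⟩
  intro z hz
  have heq : tailIdeal lam (M N) (hM N) = tailIdeal lam (M n) (hM n) := hN n hn
  rw [← mem_tailIdeal (hM := hM n), ← heq] at hz
  exact mem_tailIdeal.1 hz

theorem BaxterACC.isNoetherian (hacc : BaxterACC C A 0) {f : A →ₗ[C] C}
    (hf : Function.Surjective f) : IsNoetherian C A :=
  monotone_stabilizes_iff_noetherian.1 fun M => hacc.stabilizes hf M fun _ => Or.inl rfl

theorem BaxterACC.isNoetherianRing (hacc : BaxterACC C A lam) {f : A →ₗ[C] C}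
    (hf : Function.Surjective f) : IsNoetherianRing A := by
  refine monotone_stabilizes_iff_noetherian.1 fun J => ?_
  obtain ⟨N, hN⟩ := hacc.stabilizes hf
    ⟨fun n => (J n).restrictScalars C, fun i j hij => J.monotone hij⟩
    fun n => Or.inr fun a x hx => (J n).smul_mem a hx
  exact ⟨N, fun n hn => Submodule.restrictScalars_injective C A A (hN n hn)⟩

end

/-! ### Failure of the chain conditions in polynomial rings -/

section MvPolynomial

variable (X C : Type*) [CommRing C]

theorem constantCoeff_surjective :
    Function.Surjective (MvPolynomial.lcoeff C (0 : X →₀ ℕ)) := fun c =>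
  ⟨MvPolynomial.C c, by simp⟩

variable [Nontrivial C]

/-- The monomials form a basis indexed by `X →₀ ℕ`, which is infinite; a finite module over a
nontrivial ring has only finite bases. -/
theorem not_isNoetherian_mvPolynomial [Nonempty X] : ¬ IsNoetherian C (MvPolynomial X C) := by
  intro h
  have := Module.Finite.finite_basis (MvPolynomial.basisMonomials X C)
  exact not_finite (X →₀ ℕ)

/-- The ideals generated by the first `n` of a sequence of distinct variables form a strictly
increasing chain. -/
theorem not_isNoetherianRing_mvPolynomial [Infinite X] :
    ¬ IsNoetherianRing (MvPolynomial X C) := by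
  intro h
  obtain ⟨n, hn⟩ := monotone_stabilizes_iff_noetherian.2 h
    ⟨fun n => Ideal.span (MvPolynomial.X '' (Infinite.natEmbedding X '' Set.Iio n)),
      fun i j hij => Ideal.span_mono (Set.image_mono (Set.image_mono (Set.Iio_subset_Iio hij)))⟩
  have hmem : (MvPolynomial.X (Infinite.natEmbedding X n) : MvPolynomial X C) ∈
      Ideal.span (MvPolynomial.X '' (Infinite.natEmbedding X '' Set.Iio n)) := by
    refine (hn (n + 1) n.le_succ).ge ?_
    exact Ideal.subset_span ⟨_, ⟨n, n.lt_succ_self, rfl⟩, rfl⟩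
  -- Membership would force an earlier variable to occur in the monomial of the `n`-th one.
  rw [MvPolynomial.mem_ideal_span_X_image] at hmem
  obtain ⟨i, ⟨k, hk, rfl⟩, hi⟩ := hmem (Finsupp.single (Infinite.natEmbedding X n) 1)
    (by simp [MvPolynomial.support_X])
  refine hi (Finsupp.single_eq_of_ne fun h => ?_)
  exact (Set.mem_Iio.1 hk).ne ((Infinite.natEmbedding X).injective h)

end MvPolynomial

end ShuffleBaxter

open ShuffleBaxter in
theorem corollary4p6 {C : Type*} [CommRing C] [Nontrivial C] :
    (∀ (A : Type*) [CommRing A] [Algebra C A], ¬ IsNoetherian C A →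
      (∃ f : A →ₗ[C] C, Function.Surjective f) → ¬ ShuffleBaxter.BaxterACC C A 0) ∧
    (∀ (X : Type*) [Nonempty X], ¬ ShuffleBaxter.BaxterACC C (MvPolynomial X C) 0) ∧
    (∀ (X : Type*) [Infinite X] (lam : C),
      ¬ ShuffleBaxter.BaxterACC C (MvPolynomial X C) lam) := by
  refine ⟨fun A _ _ hA ⟨f, hf⟩ hacc => hA (hacc.isNoetherian hf), fun X _ hacc => ?_,
    fun X _ lam hacc => ?_⟩
  · exact not_isNoetherian_mvPolynomial X C (hacc.isNoetherian (constantCoeff_surjective X C))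
  · exact not_isNoetherianRing_mvPolynomial X C
      (hacc.isNoetherianRing (constantCoeff_surjective X C))
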